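/- Let $G=(V,E)$ be a finite bipartite (simple) graph in which every node $u\in V$ has a strict total order $>_u$ on the set of its neighbours (preference lists may be incomplete, i.e. $G$ need not be complete bipartite); $v>_u w$ means that $u$ prefers $v$ to $w$. A matching is a set $M\subseteq E$ such that every node is incident to at most one edge of $M$. A matching $M$ is stable if for every edge $uv\in E\setminus M$, either $u$ is matched in $M$ to a node $w$ with $w>_u v$, or $v$ is matched in $M$ to a node $w$ with $w>_v u$. Let $\chi(M)\in\{0,1\}^E$ be the incidence vector of $M$ and let $$P(G)=\operatorname{conv}\{\chi(M)\in\mathbb R^E : M \text{ is a stable matching in } G\}.$$ For $v\in V$ let $\delta(v)$ be the set of edges incident to $v$, for an edge $uv\in E$ let $\delta^{>u}(v)=\{vw\in E : w>_v u\}$, and for $x\in\mathbb R^E$ and $J\subseteq E$ put $x(J)=\sum_{e\in J}x_e$. Let $Q(G)$ be the set of all $x\in\mathbb R^E$ such that $$x(\delta(v))\le 1\ \ (v\in V),\qquad x_e\ge 0\ \ (e\in E),\qquad x(\delta^{>a}(b))+x(\delta^{>b}(a))+x_{ab}\ge 1\ \ (ab\in E).$$ Then $P(G)=Q(G)$, and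 every vertex (extreme point) of $Q(G)$ is integral, i.e. has only integer coordinates. -/

import Mathlib

/-- Strict preference lists on a graph `G`: each node `u` carries a strict total order `>_u` on its
set of neighbours. `prefers u v w` means `v >_u w`, that is, `u` prefers `v` to `w`; it is only
meaningful, and only ever used below, when `v` and `w` are neighbours of `u`. -/
structure PreferenceSystem {V : Type*} (G : SimpleGraph V) where
  prefers : V → V → V → Prop
  strictTotal : ∀ u : V,
    IsStrictTotalOrder (G.neighborSet u) (fun v w => prefers u (v : V) (w : V))

namespace PreferenceSystem

variable {V : Type*} {G : SimpleGraph V}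

/-- `M` is a matching: each node is incident to at most one edge in `M`. -/
def IsMatching (M : Set G.edgeSet) : Prop :=
  ∀ v : V, ∀ e ∈ M, ∀ f ∈ M, v ∈ (e : Sym2 V) → v ∈ (f : Sym2 V) → e = f

/-- `M(u) >_u v`: the node `u` is matched in `M`, to a node that it prefers to `v`. (An unmatched
node has `M(u) = ∅`, which is least preferred, so this fails then.) -/
def PartnerBetter (p : PreferenceSystem G) (M : Set G.edgeSet) (u v : V) : Prop :=
  ∃ (w : V) (h : G.Adj u w), (⟨s(u, w), h⟩ : G.edgeSet) ∈ M ∧ p.prefers u w v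

/-- `M` is a stable matching: for every edge `uv` not in `M`, `M(u) >_u v` or `M(v) >_v u`. -/
def IsStableMatching (p : PreferenceSystem G) (M : Set G.edgeSet) : Prop :=
  IsMatching M ∧
    ∀ (u v : V) (h : G.Adj u v), (⟨s(u, v), h⟩ : G.edgeSet) ∉ M →
      p.PartnerBetter M u v ∨ p.PartnerBetter M v u

/-- The incidence vector `χ(M) ∈ ℝ^E`. -/
noncomputable def incidenceVector (M : Set G.edgeSet) : G.edgeSet → ℝ :=
  M.indicator (fun _ => 1)

/-- The stable matching polytope `P(G)`. -/
def stableMatchingPolytope (p : PreferenceSystem G) : Set (G.edgeSet → ℝ) :=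
  convexHull ℝ {x | ∃ M : Set G.edgeSet, p.IsStableMatching M ∧ x = incidenceVector M}

/-- `δ(v)`: the edges incident to `v`. -/
def incidentEdges (v : V) : Set G.edgeSet :=
  {e | v ∈ (e : Sym2 V)}

/-- `δ^{>u}(v)`: the edges `vw` with `w >_v u`. -/
def betterEdges (p : PreferenceSystem G) (u v : V) : Set G.edgeSet :=
  {e | ∃ w : V, (e : Sym2 V) = s(v, w) ∧ p.prefers v w u}

open Classical in
/-- `x(J) = ∑_{e ∈ J} x_e` for a set `J` of edges of a finite graph. -/
noncomputable def edgeSum [Fintype V] (x : G.edgeSet → ℝ) (J : Set G.edgeSet) : ℝ :=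
  ∑ e : G.edgeSet with e ∈ J, x e

/-- The polytope `Q(G)`, given by the degree, nonnegativity and stability constraints. -/
def rothblumPolytope [Fintype V] (p : PreferenceSystem G) : Set (G.edgeSet → ℝ) :=
  {x | (∀ v : V, edgeSum x (incidentEdges v) ≤ 1) ∧ (∀ e : G.edgeSet, 0 ≤ x e) ∧
    ∀ (a b : V) (h : G.Adj a b),
      1 ≤ edgeSum x (p.betterEdges a b) + edgeSum x (p.betterEdges b a) + x ⟨s(a, b), h⟩}

end PreferenceSystem

/-! Incidence vectors of stable matchings satisfy the constraints, which gives one inclusion. For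
the other, a point `x` of the polytope is written as an average of stable matchings. Multiplying
each stability constraint by `x e` and summing over ordered adjacent pairs gives a nonnegative total
equal to `∑ v, (d v ^ 2 - d v)`, with `d v ≤ 1` the degree sum. Hence the constraint is tight
wherever `x e > 0` (`preferredWeight_add_eq_one`). Let each node of `A` lay its edges along the unit
interval, best first, and select the edge over `θ`. Tightness says that the other side sees the same
selection at `1 - θ`, so it is a stable matching (`isStableMatching_thresholdMatching`). An edge is
selected for a set of `θ` of length `x e`, so integrating over `θ` recovers `x`. Integrality follows
because extreme points of a hull are generators. -/

namespace PreferenceSystem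

open MeasureTheory

/-! ### Partial sums along a finite strict order -/

section StrictOrder

variable {α : Type*} [Fintype α] (r : α → α → Prop) [IsStrictTotalOrder α r]

open Classical in
/-- The total weight of the elements that precede `w`. -/
noncomputable def weightBelow (f : α → ℝ) (w : α) : ℝ := ∑ u with r u w, f u

variable {r}

lemma weightBelow_add_le_of_rel {f : α → ℝ} (hf : ∀ u, 0 ≤ f u) {u w : α} (h : r u w) :
    weightBelow r f u + f u ≤ weightBelow r f w := by
  classical
  unfold weightBelow
  rw [add_comm, ← Finset.sum_insert (by simp [irrefl_of r u])]
  refine Finset.sum_le_sum_of_subset_of_nonneg ?_ fun i _ _ => hf i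
  intro v hv
  simp only [Finset.mem_insert, Finset.mem_filter, Finset.mem_univ, true_and] at hv ⊢
  rcases hv with rfl | hv
  · exact h
  · exact trans_of r hv h

lemma weightBelow_add_le_sum {f : α → ℝ} (hf : ∀ u, 0 ≤ f u) (w : α) :
    weightBelow r f w + f w ≤ ∑ u, f u := by
  classical
  unfold weightBelow
  rw [add_comm, ← Finset.sum_insert (by simp [irrefl_of r w])]
  exact Finset.sum_le_sum_of_subset_of_nonneg (Finset.subset_univ _) fun i _ _ => hf i

/-- The weight below `w` is zero or is the weight up to the immediate predecessor of `w`. -/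
lemma weightBelow_eq_zero_or (f : α → ℝ) (w : α) :
    weightBelow r f w = 0 ∨ ∃ u, r u w ∧ weightBelow r f w = weightBelow r f u + f u := by
  classical
  by_cases hne : ∃ u, r u w
  · right
    have hwf : WellFounded (Function.swap r) := Finite.wellFounded_of_trans_of_irrefl _
    obtain ⟨u, hu, hmax⟩ := hwf.has_min {u | r u w} hne
    refine ⟨u, hu, ?_⟩
    unfold weightBelow
    rw [add_comm, ← Finset.sum_insert (by simp [irrefl_of r u])]
    congr 1
    ext v
    simp only [Finset.mem_insert, Finset.mem_filter, Finset.mem_univ, true_and]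
    constructor
    · intro hv
      rcases trichotomous_of r v u with h | h | h
      · exact Or.inr h
      · exact Or.inl h
      · exact absurd h (hmax v hv)
    · rintro (rfl | hv)
      · exact hu
      · exact trans_of r hv hu
  · left
    push Not at hne
    exact Finset.sum_eq_zero fun u hu => absurd (Finset.mem_filter.1 hu).2 (hne u)

/-- A property of partial sums that fails at zero and holds below `w` is acquired at some element
that precedes `w`. -/
lemma exists_rel_of_weightBelow (f : α → ℝ) (P : ℝ → Prop) (h0 : ¬ P 0) (w : α)
    (hw : P (weightBelow r f w)) :
    ∃ u, r u w ∧ ¬ P (weightBelow r f u) ∧ P (weightBelow r f u + f u) := by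
  have hwf : WellFounded r := Finite.wellFounded_of_trans_of_irrefl _
  induction w using hwf.induction with
  | _ w ih =>
    rcases weightBelow_eq_zero_or (r := r) f w with h | ⟨u, hu, h⟩
    · exact absurd (h ▸ hw) h0
    · by_cases hPu : P (weightBelow r f u)
      · obtain ⟨t, ht, h1⟩ := ih u hu hPu
        exact ⟨t, trans_of r ht hu, h1⟩
      · exact ⟨u, hu, hPu, h ▸ hw⟩

/-- In the expanded square, each pair of distinct elements contributes twice its product, charged
here to the later element. -/
lemma sum_mul_two_weightBelow_add (f : α → ℝ) :
    ∑ w, f w * (2 * weightBelow r f w + f w) = (∑ w, f w) ^ 2 := by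
  classical
  have hsplit : ∀ w u, f w * f u =
      (if r u w then f w * f u else 0) + (if r w u then f w * f u else 0) +
        (if w = u then f w * f u else 0) := by
    intro w u
    rcases trichotomous_of r w u with h | h | h
    · have h1 : ¬ r u w := asymm_of r h
      have h2 : w ≠ u := fun e => irrefl_of r u (e ▸ h)
      simp [h, h1, h2]
    · subst h
      simp [irrefl_of r w]
    · have h1 : ¬ r w u := asymm_of r h
      have h2 : w ≠ u := fun e => irrefl_of r u (e ▸ h)
      simp [h, h1, h2]
  have hbelow : ∀ w, f w * weightBelow r f w = ∑ u, if r u w then f w * f u else 0 := by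
    intro w
    rw [weightBelow, Finset.mul_sum, Finset.sum_filter]
  have hswap : ∑ w, ∑ u, (if r w u then f w * f u else 0) =
      ∑ w, ∑ u, if r u w then f w * f u else 0 := by
    rw [Finset.sum_comm]
    simp only [mul_comm]
  rw [sq, Finset.sum_mul_sum]
  rw [Finset.sum_congr rfl fun w _ => Finset.sum_congr rfl fun u _ => hsplit w u]
  simp_rw [Finset.sum_add_distrib]
  rw [hswap]
  simp_rw [← hbelow]
  simp only [Finset.sum_ite_eq, Finset.mem_univ, if_true]
  rw [← Finset.sum_add_distrib, ← Finset.sum_add_distrib]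
  exact Finset.sum_congr rfl fun w _ => by ring

end StrictOrder

/-! ### Edge sums at a node -/

variable {V : Type*} {G : SimpleGraph V}

instance (p : PreferenceSystem G) (v : V) :
    IsStrictTotalOrder (G.neighborSet v) (fun u w => p.prefers v (u : V) (w : V)) :=
  p.strictTotal v

/-- The edge that joins `v` to one of its neighbours. -/
def edgeTo (v : V) (w : G.neighborSet v) : G.edgeSet := ⟨s(v, w), w.2⟩

lemma edgeTo_injective (v : V) : Function.Injective (edgeTo (G := G) v) := by
  intro u w h
  have h' : s(v, (u : V)) = s(v, (w : V)) := congrArg Subtype.val h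
  exact Subtype.ext (Sym2.congr_right.1 h')

lemma edgeTo_swap {a b : V} (h : G.Adj a b) :
    edgeTo b (⟨a, h.symm⟩ : G.neighborSet b) = edgeTo a (⟨b, h⟩ : G.neighborSet a) :=
  Subtype.ext Sym2.eq_swap

lemma exists_edgeTo_eq {v : V} {e : G.edgeSet} (h : v ∈ (e : Sym2 V)) :
    ∃ w : G.neighborSet v, edgeTo v w = e := by
  obtain ⟨w, hw⟩ := h
  refine ⟨⟨w, ?_⟩, Subtype.ext hw.symm⟩
  have := e.2
  rwa [hw] at this

lemma edgeTo_mem_betterEdges (p : PreferenceSystem G) {a v : V} {w : G.neighborSet v} :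
    edgeTo v w ∈ p.betterEdges a v ↔ p.prefers v w a := by
  constructor
  · rintro ⟨u, hu, h⟩
    have : (w : V) = u := Sym2.congr_right.1 hu
    rwa [this]
  · exact fun h => ⟨w, rfl, h⟩

lemma incidenceVector_nonneg (M : Set G.edgeSet) (e : G.edgeSet) : 0 ≤ incidenceVector M e :=
  Set.indicator_nonneg (fun _ _ => zero_le_one) e

lemma exists_mem_edgeTo_eq {A : Set V} (hA : ∀ a b, G.Adj a b → (a ∈ A ↔ b ∉ A)) (e : G.edgeSet) :
    ∃ a ∈ A, ∃ b : G.neighborSet a, edgeTo a b = e := by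
  obtain ⟨⟨u, v⟩, h⟩ := e
  by_cases hu : u ∈ A
  · exact ⟨u, hu, ⟨v, h⟩, rfl⟩
  · exact ⟨v, (hA v u (G.adj_symm h)).2 hu, ⟨u, G.adj_symm h⟩, edgeTo_swap h⟩

section Finite

variable [Fintype V]

open Classical in
lemma edgeSum_eq_sum_neighborSet (x : G.edgeSet → ℝ) (v : V) (J : Set G.edgeSet)
    (hJ : ∀ e ∈ J, v ∈ (e : Sym2 V)) :
    edgeSum x J = ∑ w : G.neighborSet v with edgeTo v w ∈ J, x (edgeTo v w) := by
  rw [edgeSum]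
  symm
  refine Finset.sum_bij (fun w _ => edgeTo v w) ?_ ?_ ?_ ?_
  · intro w hw
    simpa using hw
  · intro u _ w _ h
    exact edgeTo_injective v h
  · intro e he
    have he' : e ∈ J := by simpa using he
    obtain ⟨w, rfl⟩ := exists_edgeTo_eq (hJ e he')
    exact ⟨w, by simpa using he', rfl⟩
  · intro w _
    rfl

open Classical in
lemma edgeSum_incidentEdges (x : G.edgeSet → ℝ) (v : V) :
    edgeSum x (incidentEdges v) = ∑ w : G.neighborSet v, x (edgeTo v w) := by
  rw [edgeSum_eq_sum_neighborSet x v (incidentEdges v) fun e he => he]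
  congr 1
  ext w
  simp [incidentEdges, edgeTo]

variable (p : PreferenceSystem G)

open Classical in
/-- The total weight of the edges at `v` to neighbours that `v` prefers to `w`. -/
noncomputable def preferredWeight (x : G.edgeSet → ℝ) (v : V) (w : G.neighborSet v) : ℝ :=
  weightBelow (fun u w : G.neighborSet v => p.prefers v (u : V) (w : V)) (fun u => x (edgeTo v u)) w

lemma edgeSum_betterEdges (x : G.edgeSet → ℝ) (v : V) (w : G.neighborSet v) :
    edgeSum x (p.betterEdges w v) = p.preferredWeight x v w := by
  classical
  rw [edgeSum_eq_sum_neighborSet x v (p.betterEdges w v), preferredWeight, weightBelow]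
  · simp only [edgeTo_mem_betterEdges]
  · rintro e ⟨u, hu, -⟩
    rw [hu]
    exact Sym2.mem_mk_left _ _

lemma sum_neighborSet_comm [∀ v, Fintype (G.neighborSet v)] (F : ∀ v, G.neighborSet v → ℝ) :
    ∑ v, ∑ w : G.neighborSet v, F v w = ∑ v, ∑ w : G.neighborSet v, F w ⟨v, w.2.symm⟩ := by
  rw [Finset.sum_sigma', Finset.sum_sigma']
  refine Finset.sum_bij' (fun e _ => ⟨e.2, ⟨e.1, e.2.2.symm⟩⟩) (fun e _ => ⟨e.2, ⟨e.1, e.2.2.symm⟩⟩)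
    ?_ ?_ ?_ ?_ ?_ <;> simp

/-! ### Tightness on the support -/

variable {p}

/-- A point of the polytope satisfies the stability constraint with equality on its support. -/
lemma preferredWeight_add_eq_one {x : G.edgeSet → ℝ} (hx : x ∈ p.rothblumPolytope) {a b : V}
    (h : G.Adj a b) (hpos : 0 < x (edgeTo a ⟨b, h⟩)) :
    p.preferredWeight x b ⟨a, h.symm⟩ + p.preferredWeight x a ⟨b, h⟩ + x (edgeTo a ⟨b, h⟩) = 1 := by
  classical
  obtain ⟨hdeg, hnn, hst⟩ := hx
  let S : ∀ v, G.neighborSet v → ℝ := fun v w =>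
    p.preferredWeight x w ⟨v, w.2.symm⟩ + p.preferredWeight x v w + x (edgeTo v w)
  have hS : ∀ v w, 0 ≤ x (edgeTo v w) * (S v w - 1) := by
    intro v w
    have := hst v w w.2
    rw [p.edgeSum_betterEdges x v w, p.edgeSum_betterEdges x w ⟨v, w.2.symm⟩] at this
    exact mul_nonneg (hnn _) (sub_nonneg.2 this)
  have hdegree : ∀ v, ∑ w : G.neighborSet v, x (edgeTo v w) ≤ 1 := fun v => by
    rw [← edgeSum_incidentEdges]
    exact hdeg v
  -- Reversing the ordered pairs makes both endpoints contribute equally, which supplies the factor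
  -- 2 in the square identity.
  have hswap : ∑ v, ∑ w : G.neighborSet v, x (edgeTo v w) * p.preferredWeight x w ⟨v, w.2.symm⟩ =
      ∑ v, ∑ w : G.neighborSet v, x (edgeTo v w) * p.preferredWeight x v w := by
    rw [sum_neighborSet_comm fun v w => x (edgeTo v w) * p.preferredWeight x v w]
    refine Finset.sum_congr rfl fun v _ => Finset.sum_congr rfl fun w _ => ?_
    rw [edgeTo_swap w.2]
  have hsq : ∑ v, ∑ w : G.neighborSet v, x (edgeTo v w) * S v w =
      ∑ v, (∑ w : G.neighborSet v, x (edgeTo v w)) ^ 2 := by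
    have : ∀ v, (∑ w : G.neighborSet v, x (edgeTo v w)) ^ 2 =
        ∑ w : G.neighborSet v, x (edgeTo v w) * (2 * p.preferredWeight x v w + x (edgeTo v w)) :=
      fun v => (sum_mul_two_weightBelow_add
        (r := fun u w : G.neighborSet v => p.prefers v (u : V) (w : V)) _).symm
    simp only [this, S, mul_add, two_mul, Finset.sum_add_distrib, hswap]
  have htotal : ∑ v, ∑ w : G.neighborSet v, x (edgeTo v w) * (S v w - 1) ≤ 0 := by
    simp only [mul_sub, mul_one, Finset.sum_sub_distrib, hsq]
    rw [sub_nonpos]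
    refine Finset.sum_le_sum fun v _ => ?_
    rw [sq]
    exact mul_le_of_le_one_left (Finset.sum_nonneg fun w _ => hnn _) (hdegree v)
  have hzero : x (edgeTo a ⟨b, h⟩) * (S a ⟨b, h⟩ - 1) ≤ 0 := by
    refine le_trans ?_ htotal
    refine le_trans ?_ (Finset.single_le_sum (fun v _ => Finset.sum_nonneg fun w _ => hS v w)
      (Finset.mem_univ a))
    exact Finset.single_le_sum (f := fun w => x (edgeTo a w) * (S a w - 1)) (fun w _ => hS a w)
      (Finset.mem_univ (⟨b, h⟩ : G.neighborSet a))
  have := (mul_eq_zero.1 (le_antisymm hzero (hS a ⟨b, h⟩))).resolve_left hpos.ne'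
  exact sub_eq_zero.1 this

/-! ### Stable matchings satisfy the constraints -/

lemma edgeSum_smul_add_smul (x y : G.edgeSet → ℝ) (s t : ℝ) (J : Set G.edgeSet) :
    edgeSum (s • x + t • y) J = s * edgeSum x J + t * edgeSum y J := by
  simp [edgeSum, Finset.sum_add_distrib, Finset.mul_sum]

variable (p) in
lemma convex_rothblumPolytope : Convex ℝ p.rothblumPolytope := by
  rintro x ⟨hx1, hx2, hx3⟩ y ⟨hy1, hy2, hy3⟩ s t hs ht hst
  refine ⟨fun v => ?_, fun e => ?_, fun a b h => ?_⟩
  · rw [edgeSum_smul_add_smul]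
    linarith [mul_le_mul_of_nonneg_left (hx1 v) hs, mul_le_mul_of_nonneg_left (hy1 v) ht]
  · exact add_nonneg (mul_nonneg hs (hx2 e)) (mul_nonneg ht (hy2 e))
  · rw [edgeSum_smul_add_smul, edgeSum_smul_add_smul]
    simp only [Pi.add_apply, Pi.smul_apply, smul_eq_mul]
    linarith [mul_le_mul_of_nonneg_left (hx3 a b h) hs, mul_le_mul_of_nonneg_left (hy3 a b h) ht]

lemma edgeSum_nonneg {x : G.edgeSet → ℝ} (hx : ∀ e, 0 ≤ x e) (J : Set G.edgeSet) :
    0 ≤ edgeSum x J :=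
  Finset.sum_nonneg fun e _ => hx e

lemma le_edgeSum {x : G.edgeSet → ℝ} (hx : ∀ e, 0 ≤ x e) {J : Set G.edgeSet} {e : G.edgeSet}
    (he : e ∈ J) : x e ≤ edgeSum x J := by
  classical
  exact Finset.single_le_sum (f := x) (fun e _ => hx e) (by simpa using he)

lemma PartnerBetter.one_le_edgeSum {M : Set G.edgeSet} {u v : V} (h : p.PartnerBetter M u v) :
    1 ≤ edgeSum (incidenceVector M) (p.betterEdges v u) := by
  obtain ⟨w, hw, hM, hpref⟩ := h
  refine le_trans (le_of_eq ?_) (le_edgeSum (incidenceVector_nonneg M) (e := ⟨s(u, w), hw⟩)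
    ⟨w, rfl, hpref⟩)
  rw [incidenceVector, Set.indicator_of_mem hM]

lemma IsStableMatching.incidenceVector_mem {M : Set G.edgeSet} (hM : p.IsStableMatching M) :
    incidenceVector M ∈ p.rothblumPolytope := by
  classical
  refine ⟨fun v => ?_, incidenceVector_nonneg M, fun a b h => ?_⟩
  · simp only [edgeSum, incidenceVector, Set.indicator_apply]
    rw [← Finset.sum_filter, Finset.sum_const, nsmul_eq_mul, mul_one, ← Nat.cast_one, Nat.cast_le,
      Finset.card_le_one]
    intro e he f hf
    simp only [Finset.mem_filter, Finset.mem_univ, true_and] at he hf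
    exact hM.1 v e he.2 f hf.2 he.1 hf.1
  · have h1 := edgeSum_nonneg (incidenceVector_nonneg M) (p.betterEdges a b)
    have h2 := edgeSum_nonneg (incidenceVector_nonneg M) (p.betterEdges b a)
    have h3 := incidenceVector_nonneg M ⟨s(a, b), h⟩
    by_cases hab : (⟨s(a, b), h⟩ : G.edgeSet) ∈ M
    · have : incidenceVector M ⟨s(a, b), h⟩ = 1 := Set.indicator_of_mem hab _
      linarith
    · rcases hM.2 a b h hab with hb | hb <;> linarith [hb.one_le_edgeSum]

/-! ### Threshold rounding -/

variable (p) in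
/-- The edges chosen at the threshold `θ`: each node `a` of the side `A` lays out the weights of its
edges on the unit interval from best to worst, and takes the edge whose interval contains `θ`. -/
def thresholdMatching (A : Set V) (x : G.edgeSet → ℝ) (θ : ℝ) : Set G.edgeSet :=
  {e | ∃ a ∈ A, ∃ b : G.neighborSet a, edgeTo a b = e ∧
    θ ∈ Set.Ico (p.preferredWeight x a b) (p.preferredWeight x a b + x (edgeTo a b))}

variable {A : Set V} {x : G.edgeSet → ℝ} {θ : ℝ}

lemma edgeTo_mem_thresholdMatching (hA : ∀ a b, G.Adj a b → (a ∈ A ↔ b ∉ A)) {a : V} (ha : a ∈ A)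
    (b : G.neighborSet a) : edgeTo a b ∈ p.thresholdMatching A x θ ↔
      θ ∈ Set.Ico (p.preferredWeight x a b) (p.preferredWeight x a b + x (edgeTo a b)) := by
  constructor
  · rintro ⟨a', ha', b', he, hθ⟩
    have he' : s(a', (b' : V)) = s(a, (b : V)) := congrArg Subtype.val he
    have haa : a' = a := by
      rcases Sym2.eq_iff.1 he' with ⟨h, -⟩ | ⟨h, -⟩
      · exact h
      · exact absurd (h ▸ ha') ((hA a b b.2).1 ha)
    subst haa
    rwa [← edgeTo_injective _ he]
  · exact fun h => ⟨a, ha, b, rfl, h⟩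

/-- Seen from the other side, the intervals are laid out from worst to best. -/
lemma edgeTo_mem_thresholdMatching_of_notMem (hA : ∀ a b, G.Adj a b → (a ∈ A ↔ b ∉ A))
    (hx : x ∈ p.rothblumPolytope) {b : V} (hb : b ∉ A) (a : G.neighborSet b) :
    edgeTo b a ∈ p.thresholdMatching A x θ ↔
      1 - θ ∈ Set.Ioc (p.preferredWeight x b a) (p.preferredWeight x b a + x (edgeTo b a)) := by
  obtain ⟨a, hab⟩ := a
  have ha : a ∈ A := (hA a b (G.adj_symm hab)).2 hb
  rw [← edgeTo_swap hab, edgeTo_mem_thresholdMatching hA ha, Set.mem_Ico, Set.mem_Ioc]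
  rcases (hx.2.1 (edgeTo a ⟨b, G.adj_symm hab⟩)).eq_or_lt with h0 | hpos
  -- Tightness may fail at weight zero, but then both intervals are empty.
  · constructor <;> rintro ⟨h1, h2⟩ <;> linarith
  · have := preferredWeight_add_eq_one hx (G.adj_symm hab) hpos
    constructor <;> rintro ⟨h1, h2⟩ <;> constructor <;> linarith

lemma preferredWeight_add_le {x : G.edgeSet → ℝ} (hx : ∀ e, 0 ≤ x e) {v : V}
    {u w : G.neighborSet v} (h : p.prefers v u w) :
    p.preferredWeight x v u + x (edgeTo v u) ≤ p.preferredWeight x v w := by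
  classical
  exact weightBelow_add_le_of_rel (r := fun u w : G.neighborSet v => p.prefers v (u : V) (w : V))
    (f := fun u => x (edgeTo v u)) (fun u => hx _) h

lemma isMatching_thresholdMatching (hA : ∀ a b, G.Adj a b → (a ∈ A ↔ b ∉ A))
    (hx : x ∈ p.rothblumPolytope) : IsMatching (p.thresholdMatching A x θ) := by
  intro v e he f hf hve hvf
  obtain ⟨u, rfl⟩ := exists_edgeTo_eq hve
  obtain ⟨w, rfl⟩ := exists_edgeTo_eq hvf
  by_cases hv : v ∈ A
  · rw [edgeTo_mem_thresholdMatching hA hv, Set.mem_Ico] at he hf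
    rcases trichotomous_of (fun u w : G.neighborSet v => p.prefers v (u : V) (w : V)) u w with
      h | h | h
    · linarith [preferredWeight_add_le hx.2.1 h]
    · rw [h]
    · linarith [preferredWeight_add_le hx.2.1 h]
  · rw [edgeTo_mem_thresholdMatching_of_notMem hA hx hv, Set.mem_Ioc] at he hf
    rcases trichotomous_of (fun u w : G.neighborSet v => p.prefers v (u : V) (w : V)) u w with
      h | h | h
    · linarith [preferredWeight_add_le hx.2.1 h]
    · rw [h]
    · linarith [preferredWeight_add_le hx.2.1 h]

/-- If `θ` lies before the interval of `b`, then `a` has selected a better edge. If it lies after,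
the stability constraint leaves `b` weight at least `1 - θ` on nodes better than `a`, so its partner
is among them. -/
lemma partnerBetter_or_of_mem (hA : ∀ a b, G.Adj a b → (a ∈ A ↔ b ∉ A))
    (hx : x ∈ p.rothblumPolytope) (hθ : θ ∈ Set.Ico (0 : ℝ) 1) {a b : V} (ha : a ∈ A)
    (h : G.Adj a b) (hM : edgeTo a ⟨b, h⟩ ∉ p.thresholdMatching A x θ) :
    p.PartnerBetter (p.thresholdMatching A x θ) a b ∨
      p.PartnerBetter (p.thresholdMatching A x θ) b a := by
  classical
  have hb : b ∉ A := (hA a b h).1 ha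
  rw [edgeTo_mem_thresholdMatching hA ha, Set.mem_Ico, not_and, not_lt] at hM
  rcases lt_or_ge θ (p.preferredWeight x a ⟨b, h⟩) with hlt | hge
  · left
    obtain ⟨u, hu, h1, h2⟩ := exists_rel_of_weightBelow
      (r := fun u w : G.neighborSet a => p.prefers a (u : V) (w : V))
      (fun u => x (edgeTo a u)) (fun t => θ < t) (not_lt.2 hθ.1) ⟨b, h⟩ hlt
    exact ⟨u, u.2, (edgeTo_mem_thresholdMatching hA ha u).2 ⟨not_lt.1 h1, h2⟩, hu⟩
  · right
    have hst : 1 ≤ p.preferredWeight x b ⟨a, h.symm⟩ + p.preferredWeight x a ⟨b, h⟩ +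
        x (edgeTo a ⟨b, h⟩) := by
      rw [← edgeSum_betterEdges, ← edgeSum_betterEdges]
      exact hx.2.2 a b h
    have hle : 1 - θ ≤ p.preferredWeight x b ⟨a, h.symm⟩ := by linarith [hM hge]
    obtain ⟨u, hu, h1, h2⟩ := exists_rel_of_weightBelow
      (r := fun u w : G.neighborSet b => p.prefers b (u : V) (w : V))
      -- The strict bound `θ < 1` makes the property fail at zero.
      (fun u => x (edgeTo b u)) (fun t => 1 - θ ≤ t) (by linarith [hθ.2]) ⟨a, h.symm⟩ hle
    exact ⟨u, u.2, (edgeTo_mem_thresholdMatching_of_notMem hA hx hb u).2 ⟨not_le.1 h1, h2⟩, hu⟩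

lemma isStableMatching_thresholdMatching (hA : ∀ a b, G.Adj a b → (a ∈ A ↔ b ∉ A))
    (hx : x ∈ p.rothblumPolytope) (hθ : θ ∈ Set.Ico (0 : ℝ) 1) :
    p.IsStableMatching (p.thresholdMatching A x θ) := by
  refine ⟨isMatching_thresholdMatching hA hx, fun u v h hM => ?_⟩
  by_cases hu : u ∈ A
  · exact partnerBetter_or_of_mem hA hx hθ hu h hM
  · have hv : v ∈ A := (hA v u h.symm).2 hu
    refine (partnerBetter_or_of_mem hA hx hθ hv h.symm ?_).symm
    rwa [edgeTo_swap h]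

lemma incidenceVector_thresholdMatching (hA : ∀ a b, G.Adj a b → (a ∈ A ↔ b ∉ A)) {a : V}
    (ha : a ∈ A) (b : G.neighborSet a) (θ : ℝ) :
    incidenceVector (p.thresholdMatching A x θ) (edgeTo a b) =
      (Set.Ico (p.preferredWeight x a b) (p.preferredWeight x a b + x (edgeTo a b))).indicator
        (fun _ => 1) θ := by
  classical
  simp only [incidenceVector, Set.indicator_apply, edgeTo_mem_thresholdMatching hA ha]

/-! ### Averaging over the threshold -/

lemma integrable_incidenceVector_thresholdMatching (hA : ∀ a b, G.Adj a b → (a ∈ A ↔ b ∉ A))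
    (e : G.edgeSet) :
    Integrable (fun θ => incidenceVector (p.thresholdMatching A x θ) e)
      (volume.restrict (Set.Ico (0 : ℝ) 1)) := by
  obtain ⟨a, ha, b, rfl⟩ := exists_mem_edgeTo_eq hA e
  simp only [incidenceVector_thresholdMatching hA ha]
  exact (integrable_const 1).indicator measurableSet_Ico

lemma integral_incidenceVector_thresholdMatching (hA : ∀ a b, G.Adj a b → (a ∈ A ↔ b ∉ A))
    (hx : x ∈ p.rothblumPolytope) (e : G.edgeSet) :
    ∫ θ in Set.Ico (0 : ℝ) 1, incidenceVector (p.thresholdMatching A x θ) e = x e := by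
  classical
  obtain ⟨a, ha, b, rfl⟩ := exists_mem_edgeTo_eq hA e
  simp only [incidenceVector_thresholdMatching hA ha]
  have h0 : 0 ≤ p.preferredWeight x a b := by
    rw [← edgeSum_betterEdges]
    exact edgeSum_nonneg hx.2.1 _
  have h1 : p.preferredWeight x a b + x (edgeTo a b) ≤ 1 := by
    refine le_trans (weightBelow_add_le_sum
      (r := fun u w : G.neighborSet a => p.prefers a (u : V) (w : V))
      (f := fun u => x (edgeTo a u)) (fun u => hx.2.1 _) b) ?_
    rw [← edgeSum_incidentEdges]
    exact hx.1 a
  rw [integral_indicator measurableSet_Ico, Measure.restrict_restrict measurableSet_Ico,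
    Set.inter_eq_left.2 (Set.Ico_subset_Ico h0 h1)]
  simp [hx.2.1 (edgeTo a b)]

lemma rothblumPolytope_subset (hA : ∀ a b, G.Adj a b → (a ∈ A ↔ b ∉ A)) :
    p.rothblumPolytope ⊆ p.stableMatchingPolytope := by
  classical
  intro x hx
  -- Finiteness makes the hull closed, so it contains averages of its points.
  have hfin : {y | ∃ M : Set G.edgeSet, p.IsStableMatching M ∧ y = incidenceVector M}.Finite := by
    refine (Set.finite_range (incidenceVector (G := G))).subset ?_
    rintro _ ⟨M, -, rfl⟩
    exact Set.mem_range_self M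
  have : IsProbabilityMeasure (volume.restrict (Set.Ico (0 : ℝ) 1)) := ⟨by simp⟩
  have hint := integrable_incidenceVector_thresholdMatching (p := p) (x := x) hA
  have hmem : ∫ θ in Set.Ico (0 : ℝ) 1, incidenceVector (p.thresholdMatching A x θ) ∈
      p.stableMatchingPolytope := by
    refine (convex_convexHull ℝ _).integral_mem (hfin.isClosed_convexHull ℝ) ?_
      (Integrable.of_eval hint)
    filter_upwards [ae_restrict_mem measurableSet_Ico] with θ hθ
    exact subset_convexHull ℝ _ ⟨_, isStableMatching_thresholdMatching hA hx hθ, rfl⟩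
  convert hmem
  ext e
  rw [eval_integral hint, integral_incidenceVector_thresholdMatching hA hx]

end Finite

end PreferenceSystem

open PreferenceSystem in
theorem mainTheorem1 {V : Type*} [Fintype V] (G : SimpleGraph V) (hG : G.IsBipartite)
    (p : PreferenceSystem G) :
    p.stableMatchingPolytope = p.rothblumPolytope ∧
      ∀ x ∈ p.rothblumPolytope.extremePoints ℝ, ∀ e : G.edgeSet, ∃ n : ℤ, x e = n := by
  obtain ⟨c⟩ := hG
  have hA : ∀ a b, G.Adj a b → (a ∈ {v | c v = 0} ↔ b ∉ {v | c v = 0}) := by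
    intro a b h
    have := c.valid h
    simp only [Set.mem_ofPred_eq]
    omega
  have heq : p.stableMatchingPolytope = p.rothblumPolytope := by
    refine Set.Subset.antisymm (convexHull_min ?_ (convex_rothblumPolytope p))
      (rothblumPolytope_subset hA)
    rintro _ ⟨M, hM, rfl⟩
    exact hM.incidenceVector_mem
  refine ⟨heq, fun x hx e => ?_⟩
  rw [← heq] at hx
  obtain ⟨M, -, rfl⟩ := extremePoints_convexHull_subset hx
  by_cases he : e ∈ M
  · exact ⟨1, by simp [incidenceVector, he]⟩
  · exact ⟨0, by simp [incidenceVector, he]⟩
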